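/- Let $d\in\mathbb{N}$, let $M\subseteq\mathbb{R}^d$ be a Borel set that is symmetric about the origin ($-M=M$), and let $\mu$ be a finite measure on the Borel subsets of $M$ that is invariant under the reflection $t\mapsto -t$. Let $X_1,X_2,\ldots$ and $Y_1,Y_2,\ldots$ be jointly independent random vectors in $\mathbb{R}^d$ on a common probability space, where the $X_j$ are identically distributed with characteristic function $\varphi$ and the $Y_k$ are identically distributed with characteristic function $\psi$, and suppose that $\varphi=\psi$. Let $\varphi_n(t)=\frac1n\sum_{j=1}^n e^{\mathrm{i}t^\top X_j}$ and $\psi_m(t)=\frac1m\sum_{k=1}^m e^{\mathrm{i}t^\top Y_k}$ be the empirical characteristic functions, and put $$T_{n,m}=\frac{nm}{n+m}\int_M|\varphi_n(t)-\psi_m(t)|^2\,\mu(\mathrm{d}t).$$ Let $\mathbb{H}=L^2(M,\mathcal{B}(M),\mu)$ be the real Hilbert space of square-integrable functions, and let $\mathrm{CS}(\xi)=\cos\xi+\sin\xi$. Then there is a centred Gaussian random element $W$ of $\mathbb{H}$ with covariance kernel $$K(s,t)=\mathrm{Cov}\big(\mathrm{CS}(s^\top X_1),\mathrm{CS}(t^\top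 X_1)\big),\quad s,t\in M,$$ i.e. $\mathrm{Cov}(\langle u,W\rangle,\langle v,W\rangle)=\int_M\int_M K(s,t)u(s)v(t)\,\mu(\mathrm{d}t)\,\mu(\mathrm{d}s)$ for all $u,v\in\mathbb{H}$, such that $T_{n,m}$ converges in distribution to $\|W\|_{\mathbb{H}}^2$ as $n,m\to\infty$ in an arbitrary manner, that is, as $\min(n,m)\to\infty$ without any condition on the ratio of $n$ and $m$. -/

import Mathlib

open MeasureTheory ProbabilityTheory Filter
open scoped Pointwise RealInnerProductSpace

/-- The function `cos + sin`. -/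
noncomputable def CS (x : ℝ) : ℝ := Real.cos x + Real.sin x

/-- The empirical characteristic function `t ↦ n⁻¹ ∑_{j < n} exp (i tᵀ x_j)` of the first `n`
points of the sequence `x`. -/
noncomputable def empCharFun {d : ℕ} (x : ℕ → EuclideanSpace ℝ (Fin d)) (n : ℕ)
    (t : EuclideanSpace ℝ (Fin d)) : ℂ :=
  (1 / (n : ℂ)) * ∑ j ∈ Finset.range n, Complex.exp (Complex.I * ((⟪t, x j⟫ : ℝ) : ℂ))

/-- The two-sample statistic
`T_{n,m} = (n m / (n + m)) ∫_M |φ_n(t) - ψ_m(t)|² μ(dt)`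
computed from the first `n` points of `x` and the first `m` points of `y`. -/
noncomputable def cfStatistic {d : ℕ} {M : Set (EuclideanSpace ℝ (Fin d))} (μ : Measure M)
    (x y : ℕ → EuclideanSpace ℝ (Fin d)) (n m : ℕ) : ℝ :=
  ((n : ℝ) * (m : ℝ) / ((n : ℝ) + (m : ℝ))) *
    ∫ t : M, ‖empCharFun x n (t : EuclideanSpace ℝ (Fin d)) -
      empCharFun y m (t : EuclideanSpace ℝ (Fin d))‖ ^ 2 ∂μ

/-- The reflection `t ↦ -t` of a set that is symmetric about the origin. -/
def reflect {d : ℕ} {M : Set (EuclideanSpace ℝ (Fin d))} (hM : -M = M) (t : M) : M :=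
  ⟨-(t : EuclideanSpace ℝ (Fin d)), by
    have h : (t : EuclideanSpace ℝ (Fin d)) ∈ -M := by rw [hM]; exact t.2
    exact h⟩

/-- The Borel `σ`-algebra on the Hilbert space `L²(μ)`. -/
noncomputable instance instMeasurableSpaceL2 {α : Type*} [MeasurableSpace α] (μ : Measure α) :
    MeasurableSpace (Lp ℝ 2 μ) := borel _

instance instBorelSpaceL2 {α : Type*} [MeasurableSpace α] (μ : Measure α) :
    BorelSpace (Lp ℝ 2 μ) := ⟨rfl⟩

/-- `K` is the covariance kernel of the random element `W` of `L²(μ)`: the covariance of the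
linear functionals `⟨u, W⟩` and `⟨v, W⟩` is `∫∫ K(s,t) u(s) v(t) μ(ds) μ(dt)`. As elements of
`L²(μ)` have no point values, this is the meaning of `K(s,t) = Cov (W(s), W(t))`. -/
def HasCovarianceKernel {α : Type*} [MeasurableSpace α] {μ : Measure α}
    {Ω : Type*} [MeasurableSpace Ω] (W : Ω → Lp ℝ 2 μ) (P : Measure Ω) (K : α → α → ℝ) : Prop :=
  ∀ u v : Lp ℝ 2 μ,
    cov[fun ω ↦ ⟪u, W ω⟫, fun ω ↦ ⟪v, W ω⟫; P] = ∫ s, ∫ t, K s t * u s * v t ∂μ ∂μ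

/-! Let a and b be the real and imaginary parts of a combination ∑ wᵢ exp(i tᵀzᵢ) with real weights.
The product a b is odd in t, so the reflection invariance of μ gives ∫ (a² + b²) dμ = ∫ (a + b)² dμ.
Hence the statistic is the squared norm in real L²(μ) of a weighted sum of the elements CS(·ᵀX_j)
and CS(·ᵀY_k) (`integral_norm_weightedSum_exp_sq`, `cfStatistic_eq_norm_sq`). The weights sum to
zero, so these elements may be centred; the squared weights sum to 1, and each weight is at most
1/√n or 1/√m in modulus, whatever the ratio of n and m. Since φ = ψ makes all the laws equal, a
central limit theorem in Hilbert space for such weights (`exists_isGaussian_tendsto_weightedSum`)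
and the continuous mapping theorem suffice.

In that limit theorem, the coordinate second moments of every weighted sum are bounded by those of a
single summand Z, whose total is E‖Z‖² < ∞; this yields tightness
(`isTightMeasureSet_of_lintegral_inner_sq_le`). Characteristic functions converge by comparison with
Gaussian factors having the same first two moments (`tendsto_prod_charFun_of_sum_sq_eq_one`). The
Gaussian limit is not constructed by hand: it is a cluster point supplied by Prokhorov's theorem.
Its covariance kernel comes from Fubini (`covariance_integral_mul`). -/

open scoped ENNReal Topology

/-! ### Tightness in complete metric spaces and in separable Hilbert spaces -/

/-- A set of measures on a complete metric space is tight as soon as, up to arbitrarily small mass,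
it is concentrated on arbitrarily small neighbourhoods of compact sets. -/
lemma isTightMeasureSet_of_forall_cthickening {E : Type*} [MetricSpace E] [CompleteSpace E]
    [MeasurableSpace E] {S : Set (Measure E)}
    (h : ∀ ε : ℝ≥0∞, 0 < ε → ∀ δ : ℝ, 0 < δ → ∃ C : Set E, IsCompact C ∧
      ∀ μ ∈ S, μ (Metric.cthickening δ C)ᶜ ≤ ε) :
    IsTightMeasureSet S := by
  rw [isTightMeasureSet_iff_exists_isCompact_measure_compl_le]
  intro ε hε
  obtain ⟨η, hη, hηsum⟩ := ENNReal.exists_pos_sum_of_countable' hε.ne' ℕ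
  have key (m : ℕ) : ∃ C : Set E, IsCompact C ∧
      ∀ μ ∈ S, μ (Metric.cthickening (1 / ((m : ℝ) + 1)) C)ᶜ ≤ η m :=
    h _ (hη m) _ Nat.one_div_pos_of_nat
  choose C hC hμ using key
  refine ⟨⋂ m : ℕ, Metric.cthickening (1 / ((m : ℝ) + 1)) (C m), ?_, fun μ hμS ↦ ?_⟩
  · refine TotallyBounded.isCompact_of_isClosed ?_
      (isClosed_iInter fun m ↦ Metric.isClosed_cthickening)
    -- A finite δ/2-net of a single `C m` with 1/(m+1) < δ/2 is a δ-net of the intersection.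
    refine Metric.totallyBounded_iff.2 fun δ hδ ↦ ?_
    obtain ⟨m, hm⟩ := exists_nat_one_div_lt (half_pos hδ)
    obtain ⟨t, ht, hCt⟩ := Metric.totallyBounded_iff.1 (hC m).totallyBounded _ (half_pos hδ)
    refine ⟨t, ht, fun x hx ↦ ?_⟩
    have hx' := Metric.cthickening_subset_thickening' (half_pos hδ) hm (C m)
      (Set.mem_iInter.1 hx m)
    obtain ⟨y, hy, hxy⟩ := Metric.mem_thickening_iff.1 hx'
    obtain ⟨z, hz, hyz⟩ := Set.mem_iUnion₂.1 (hCt hy)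
    refine Set.mem_iUnion₂.2 ⟨z, hz, ?_⟩
    rw [Metric.mem_ball] at *
    linarith [dist_triangle x y z]
  · rw [Set.compl_iInter]
    calc _ ≤ ∑' m : ℕ, μ (Metric.cthickening (1 / ((m : ℝ) + 1)) (C m))ᶜ := measure_iUnion_le _
      _ ≤ ∑' m, η m := ENNReal.tsum_le_tsum fun m ↦ hμ m μ hμS
      _ ≤ ε := hηsum.le

/-- Distinct orthonormal vectors are √2 > 1 apart, so the balls of radius 1/2 around them are
disjoint. -/
lemma Orthonormal.countable_of_separableSpace {H ι : Type*} [NormedAddCommGroup H]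
    [InnerProductSpace ℝ H] [TopologicalSpace.SeparableSpace H] {e : ι → H}
    (he : Orthonormal ℝ e) : Countable ι := by
  have hdisj : Pairwise (Function.onFun Disjoint fun i ↦ Metric.ball (e i) (1 / 2)) := by
    intro i j hij
    refine Metric.ball_disjoint_ball ?_
    have h : ‖e i - e j‖ ^ 2 = 2 := by
      rw [norm_sub_sq_real, he.1 i, he.1 j, he.2 hij]; norm_num
    rw [dist_eq_norm]
    nlinarith [norm_nonneg (e i - e j)]
  have := Pairwise.countable_of_isOpen_disjoint hdisj (fun i ↦ Metric.isOpen_ball)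
    (fun i ↦ Metric.nonempty_ball.2 (by norm_num))
  exact this

section HilbertBasis

variable {H ι : Type*} [NormedAddCommGroup H] [InnerProductSpace ℝ H]

lemma HilbertBasis.tsum_enorm_inner_sq (e : HilbertBasis ι ℝ H) (x : H) :
    ∑' i, ‖⟪e i, x⟫‖ₑ ^ 2 = ‖x‖ₑ ^ 2 := by
  have h := e.hasSum_inner_mul_inner x x
  have h' (i : ι) : ‖⟪e i, x⟫‖ₑ ^ 2 = ENNReal.ofReal (⟪x, e i⟫ * ⟪e i, x⟫) := by
    rw [Real.enorm_eq_ofReal_abs, ← ENNReal.ofReal_pow (abs_nonneg _), sq_abs, real_inner_comm x,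
      sq]
  simp_rw [h']
  rw [← ENNReal.ofReal_tsum_of_nonneg _ h.summable, h.tsum_eq, real_inner_self_eq_norm_sq,
    ENNReal.ofReal_pow (norm_nonneg _), ofReal_norm]
  intro i
  rw [real_inner_comm x]
  exact mul_self_nonneg _

/-- Parseval for the residual: its coordinates vanish on `s` and are unchanged off `s`. -/
lemma HilbertBasis.enorm_sub_sum_sq (e : HilbertBasis ι ℝ H) (s : Finset ι) (x : H) :
    ‖x - ∑ i ∈ s, ⟪e i, x⟫ • e i‖ₑ ^ 2 = ∑' i : {i // i ∉ s}, ‖⟪e i, x⟫‖ₑ ^ 2 := by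
  classical
  rw [← e.tsum_enorm_inner_sq]
  have h (i : ι) : ⟪e i, x - ∑ j ∈ s, ⟪e j, x⟫ • e j⟫ = if i ∈ s then 0 else ⟪e i, x⟫ := by
    rw [inner_sub_right, inner_sum]
    simp_rw [inner_smul_right, orthonormal_iff_ite.1 e.orthonormal]
    by_cases hi : i ∈ s <;> simp [hi]
  simp_rw [h]
  rw [← tsum_subtype_eq_of_support_subset (s := {i | i ∉ s})]
  · refine tsum_congr fun i ↦ ?_
    rw [if_neg i.2]
  · intro i hi
    by_contra hi'
    simp at hi hi'
    exact hi.1 hi'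

/-- A set of measures on a separable Hilbert space is tight if the second moments of the
coordinates with respect to a Hilbert basis have a common summable bound. -/
lemma isTightMeasureSet_of_lintegral_inner_sq_le [CompleteSpace H]
    [TopologicalSpace.SeparableSpace H] [MeasurableSpace H] [BorelSpace H]
    (e : HilbertBasis ι ℝ H) {S : Set (Measure H)} {c : ι → ℝ≥0∞} (hc : ∑' i, c i ≠ ∞)
    (h : ∀ μ ∈ S, ∀ i, ∫⁻ x, ‖⟪e i, x⟫‖ₑ ^ 2 ∂μ ≤ c i) :
    IsTightMeasureSet S := by
  have := e.orthonormal.countable_of_separableSpace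
  have hmeas (i : ι) : Measurable fun x : H ↦ ‖⟪e i, x⟫‖ₑ ^ 2 := by fun_prop
  have htail : ∀ μ ∈ S, ∀ s : Finset ι,
      ∫⁻ x, ‖x - ∑ i ∈ s, ⟪e i, x⟫ • e i‖ₑ ^ 2 ∂μ ≤ ∑' i : {i // i ∉ s}, c i := by
    intro μ hμ s
    simp_rw [e.enorm_sub_sum_sq]
    rw [lintegral_tsum fun i : {i // i ∉ s} ↦ (hmeas i).aemeasurable]
    exact ENNReal.tsum_le_tsum fun i ↦ h μ hμ i
  -- Chebyshev's inequality, used twice below: with a large `s` for the distance to a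
  -- finite-dimensional subspace, and with `s = ∅` for the norm.
  have hmarkov : ∀ μ ∈ S, ∀ s : Finset ι, ∀ δ : ℝ, 0 < δ → ∀ η : ℝ≥0∞,
      ∑' i : {i // i ∉ s}, c i ≤ η * ENNReal.ofReal δ ^ 2 →
      μ {x | δ ≤ ‖x - ∑ i ∈ s, ⟪e i, x⟫ • e i‖} ≤ η := by
    intro μ hμ s δ hδ η hη
    have h1 := meas_ge_le_lintegral_div (μ := μ)
      (f := fun x ↦ ‖x - ∑ i ∈ s, ⟪e i, x⟫ • e i‖ₑ ^ 2) (ε := ENNReal.ofReal δ ^ 2)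
      (Measurable.aemeasurable (by fun_prop)) (by simp [hδ]) (by simp)
    have h2 : {x : H | δ ≤ ‖x - ∑ i ∈ s, ⟪e i, x⟫ • e i‖} ⊆
        {x | ENNReal.ofReal δ ^ 2 ≤ ‖x - ∑ i ∈ s, ⟪e i, x⟫ • e i‖ₑ ^ 2} := by
      intro x hx
      have : ENNReal.ofReal δ ≤ ‖x - ∑ i ∈ s, ⟪e i, x⟫ • e i‖ₑ := by
        rw [← ofReal_norm]
        exact ENNReal.ofReal_le_ofReal hx
      simp only [Set.mem_ofPred_eq]
      gcongr
    refine (measure_mono h2).trans (h1.trans (ENNReal.div_le_of_le_mul ?_))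
    exact (htail μ hμ s).trans hη
  refine isTightMeasureSet_of_forall_cthickening fun ε hε δ hδ ↦ ?_
  rcases eq_or_ne ε ∞ with rfl | hε'
  · exact ⟨∅, isCompact_empty, fun _ _ ↦ le_top⟩
  have hε2 : 0 < ε / 2 := ENNReal.half_pos hε.ne'
  have hε2' : ε / 2 ≠ ∞ := (ENNReal.half_le_self.trans_lt hε'.lt_top).ne
  obtain ⟨R, hR, hRc⟩ : ∃ R : ℝ, 0 < R ∧ ∑' i, c i ≤ ε / 2 * ENNReal.ofReal R ^ 2 := by
    have h1 : Tendsto (fun R : ℝ ↦ ε / 2 * ENNReal.ofReal R ^ 2) atTop (𝓝 ∞) := by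
      have h2 : Tendsto (fun R : ℝ ↦ ENNReal.ofReal R ^ 2) atTop (𝓝 ∞) := by
        have := ((ENNReal.continuous_pow 2).tendsto ∞).comp ENNReal.tendsto_ofReal_atTop
        simpa using! this
      have := ENNReal.Tendsto.const_mul (a := ε / 2) h2 (Or.inr hε2')
      rwa [ENNReal.mul_top hε2.ne'] at this
    exact ((eventually_gt_atTop (0 : ℝ)).and
      (h1.eventually_const_le (lt_top_iff_ne_top.2 hc))).exists
  obtain ⟨s, hs⟩ : ∃ s : Finset ι, ∑' i : {i // i ∉ s}, c i ≤ ε / 2 * ENNReal.ofReal δ ^ 2 := by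
    have h1 := ENNReal.tendsto_tsum_compl_atTop_zero hc
    have h2 : 0 < ε / 2 * ENNReal.ofReal δ ^ 2 :=
      ENNReal.mul_pos hε2.ne' (by simp [hδ])
    exact ((h1.eventually (eventually_le_nhds h2))).exists
  -- The compact set consists of the vectors in the span of `e i`, `i ∈ s`, with coordinates bounded
  -- by `R`. A point farther than δ from it has a large residual or a large norm.
  refine ⟨(fun z : s → ℝ ↦ ∑ i, z i • e i) '' Metric.closedBall 0 R,
    (isCompact_closedBall _ _).image (by fun_prop), fun μ hμ ↦ ?_⟩
  have hsub : (Metric.cthickening δ ((fun z : s → ℝ ↦ ∑ i, z i • e i) '' Metric.closedBall 0 R))ᶜ ⊆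
      {x | δ ≤ ‖x - ∑ i ∈ s, ⟪e i, x⟫ • e i‖} ∪
      {x | R ≤ ‖x - ∑ i ∈ (∅ : Finset ι), ⟪e i, x⟫ • e i‖} := by
    intro x hx
    by_contra hx'
    simp only [Finset.sum_empty, sub_zero, Set.mem_union, Set.mem_ofPred_eq, not_or, not_le] at hx'
    refine hx (Metric.mem_cthickening_of_dist_le x (∑ i ∈ s, ⟪e i, x⟫ • e i) δ _
      ⟨fun i ↦ ⟪e i, x⟫, ?_, ?_⟩ ?_)
    · rw [mem_closedBall_zero_iff, pi_norm_le_iff_of_nonneg hR.le]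
      intro i
      calc ‖⟪e i, x⟫‖ ≤ ‖e i‖ * ‖x‖ := norm_inner_le_norm _ _
        _ ≤ R := by rw [e.orthonormal.1, one_mul]; exact hx'.2.le
    · exact Finset.sum_coe_sort s fun i ↦ ⟪e i, x⟫ • e i
    · rw [dist_eq_norm]; exact hx'.1.le
  calc _ ≤ _ := measure_mono hsub
    _ ≤ _ := measure_union_le _ _
    _ ≤ ε / 2 + ε / 2 := by
      gcongr
      · exact hmarkov μ hμ s δ hδ _ hs
      · refine hmarkov μ hμ ∅ R hR _ (le_trans ?_ hRc)
        exact ENNReal.tsum_comp_le_tsum_of_injective Subtype.val_injective c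
    _ = ε := ENNReal.add_halves ε

end HilbertBasis

/-! ### Products of characteristic functions on the line -/

/-- The second-order Taylor polynomial of a characteristic function at 0 depends only on the first
two moments, so it cancels in the difference. -/
lemma charFun_sub_charFun_isLittleO {μ ν : Measure ℝ} [IsProbabilityMeasure μ]
    [IsProbabilityMeasure ν] (hμ : MemLp id 2 μ) (hν : MemLp id 2 ν)
    (h1 : ∫ x, x ∂μ = ∫ x, x ∂ν) (h2 : ∫ x, x ^ 2 ∂μ = ∫ x, x ^ 2 ∂ν) :
    (fun t ↦ charFun μ t - charFun ν t) =o[𝓝 0] fun t : ℝ ↦ t ^ 2 := by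
  have hμ' := taylor_isLittleO_univ (x₀ := 0) (contDiff_charFun (n := 2) hμ)
  have hν' := taylor_isLittleO_univ (x₀ := 0) (contDiff_charFun (n := 2) hν)
  have heq (t : ℝ) : taylorWithinEval (charFun μ) 2 Set.univ 0 t =
      taylorWithinEval (charFun ν) 2 Set.univ 0 t := by
    rw [taylorWithinEval_charFun_zero hμ, taylorWithinEval_charFun_zero hν]
    simp [Finset.sum_range_succ, h1, h2]
  refine (hμ'.sub hν').congr (fun t ↦ ?_) fun t ↦ by simp
  rw [heq]; ring

lemma norm_prod_sub_prod_le_sum {κ : Type*} (s : Finset κ) (a b : κ → ℂ)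
    (ha : ∀ i ∈ s, ‖a i‖ ≤ 1) (hb : ∀ i ∈ s, ‖b i‖ ≤ 1) :
    ‖∏ i ∈ s, a i - ∏ i ∈ s, b i‖ ≤ ∑ i ∈ s, ‖a i - b i‖ := by
  classical
  induction s using Finset.induction_on with
  | empty => simp
  | insert j s hj ih =>
    rw [Finset.prod_insert hj, Finset.prod_insert hj, Finset.sum_insert hj]
    have hprod : ‖∏ i ∈ s, b i‖ ≤ 1 := by
      rw [norm_prod]
      exact Finset.prod_le_one (fun _ _ ↦ norm_nonneg _)
        fun i hi ↦ hb i (Finset.mem_insert_of_mem hi)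
    have ih' := ih (fun i hi ↦ ha i (Finset.mem_insert_of_mem hi))
      fun i hi ↦ hb i (Finset.mem_insert_of_mem hi)
    calc _ = ‖a j * (∏ i ∈ s, a i - ∏ i ∈ s, b i) + (a j - b j) * ∏ i ∈ s, b i‖ := by ring_nf
      _ ≤ ‖a j‖ * ‖∏ i ∈ s, a i - ∏ i ∈ s, b i‖ + ‖a j - b j‖ * ‖∏ i ∈ s, b i‖ := by
        rw [← norm_mul, ← norm_mul]; exact norm_add_le _ _
      _ ≤ 1 * ∑ i ∈ s, ‖a i - b i‖ + ‖a j - b j‖ * 1 := by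
        gcongr
        exact ha j (Finset.mem_insert_self j s)
      _ = _ := by ring

/-- Each factor is replaced by that of a centred Gaussian of equal variance. The Gaussian product
equals the limit exactly, because the squared weights sum to 1, and the total replacement error is
at most ∑ (ε/2) w² = ε/2. -/
lemma tendsto_prod_charFun_of_sum_sq_eq_one {κ β : Type*} {l : Filter β} {ν : Measure ℝ}
    [IsProbabilityMeasure ν] (hν : MemLp id 2 ν) (h0 : ∫ x, x ∂ν = 0) {s : β → Finset κ}
    {w : β → κ → ℝ} (hw : ∀ᶠ p in l, ∑ i ∈ s p, w p i ^ 2 = 1)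
    (hsmall : ∀ δ > 0, ∀ᶠ p in l, ∀ i ∈ s p, |w p i| < δ) :
    Tendsto (fun p ↦ ∏ i ∈ s p, charFun ν (w p i)) l
      (𝓝 (Complex.exp (-(Var[id; ν] : ℝ) / 2))) := by
  set v : NNReal := Var[id; ν].toNNReal with hv
  have hvar : Var[id; ν] = v := (Real.coe_toNNReal _ (variance_nonneg _ _)).symm
  have hg (t : ℝ) : charFun (gaussianReal 0 v) t = Complex.exp (-(v : ℝ) * (t : ℂ) ^ 2 / 2) := by
    rw [charFun_gaussianReal]; congr 1; push_cast; ring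
  have h2 : ∫ x, x ^ 2 ∂ν = v := by
    rw [← hvar, variance_eq_integral aemeasurable_id]
    simp [h0]
  have h2' : ∫ x, x ^ 2 ∂(gaussianReal 0 v) = v := by
    have := variance_id_gaussianReal (μ := 0) (v := v)
    rw [variance_eq_integral aemeasurable_id] at this
    simpa using this
  have ho := charFun_sub_charFun_isLittleO hν (memLp_id_gaussianReal (μ := 0) (v := v) 2)
    (by simp [h0]) (h2.trans h2'.symm)
  rw [Metric.tendsto_nhds]
  intro ε hε
  obtain ⟨δ, hδ, hδ'⟩ := Metric.eventually_nhds_iff.1 (ho.def (half_pos hε))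
  filter_upwards [hw, hsmall δ hδ] with p hp hps
  have hprod : ∏ i ∈ s p, charFun (gaussianReal 0 v) (w p i) =
      Complex.exp (-(Var[id; ν] : ℝ) / 2) := by
    simp_rw [hg]
    rw [← Complex.exp_sum, hvar, ← Finset.sum_div, ← Finset.mul_sum]
    have : (∑ i ∈ s p, (w p i : ℂ) ^ 2) = 1 := by exact_mod_cast hp
    rw [this, mul_one]
  rw [dist_eq_norm, ← hprod]
  calc _ ≤ ∑ i ∈ s p, ‖charFun ν (w p i) - charFun (gaussianReal 0 v) (w p i)‖ :=
        norm_prod_sub_prod_le_sum _ _ _ (fun _ _ ↦ norm_charFun_le_one _)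
          fun _ _ ↦ norm_charFun_le_one _
    _ ≤ ∑ i ∈ s p, ε / 2 * w p i ^ 2 := by
        refine Finset.sum_le_sum fun i hi ↦ ?_
        have := hδ' (y := w p i) (by simpa using hps i hi)
        simpa using this
    _ < ε := by rw [← Finset.mul_sum, hp]; linarith

lemma MeasureTheory.ProbabilityMeasure.tendsto_charFun_of_tendsto {H β : Type*} [NormedAddCommGroup H]
    [InnerProductSpace ℝ H] [MeasurableSpace H] [BorelSpace H] {l : Filter β}
    {μ : β → ProbabilityMeasure H}
    {ν : ProbabilityMeasure H} (hμ : Tendsto μ l (𝓝 ν)) (h : H) :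
    Tendsto (fun p ↦ charFun (μ p) h) l (𝓝 (charFun ν h)) := by
  rw [ProbabilityMeasure.tendsto_iff_forall_integral_rclike_tendsto ℂ] at hμ
  simp_rw [charFun_eq_integral_innerProbChar]
  exact hμ (BoundedContinuousFunction.innerProbChar h)

/-! ### Central limit theorem for weighted sums in Hilbert space -/

section WeightedSum

variable {H κ β Ω : Type*} [NormedAddCommGroup H] [InnerProductSpace ℝ H]
  [SecondCountableTopology H] [MeasurableSpace H] [BorelSpace H] [MeasurableSpace Ω]
  {P : Measure Ω} [IsProbabilityMeasure P] {U : κ → Ω → H} {Z : Ω → H}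

/-- Independence removes the cross terms, leaving (∑ w²) times the variance of one summand. The
bound does not depend on `s` or `w`, as tightness requires. -/
lemma lintegral_inner_weightedSum_sq_le (hU : ∀ i, IdentDistrib (U i) Z P P)
    (hind : iIndepFun U P) (hZ : MemLp Z 2 P) (h0 : ∀ h : H, ∫ ω, ⟪h, Z ω⟫ ∂P = 0)
    (s : Finset κ) (w : κ → ℝ) (hw : ∑ i ∈ s, w i ^ 2 ≤ 1) (h : H) :
    ∫⁻ ω, ‖⟪h, ∑ i ∈ s, w i • U i ω⟫‖ₑ ^ 2 ∂P ≤ ∫⁻ ω, ‖⟪h, Z ω⟫‖ₑ ^ 2 ∂P := by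
  have hZh : MemLp (fun ω ↦ ⟪h, Z ω⟫) 2 P := hZ.const_inner h
  have hid (i : κ) : IdentDistrib (fun ω ↦ ⟪h, U i ω⟫) (fun ω ↦ ⟪h, Z ω⟫) P P :=
    (hU i).comp (u := fun x ↦ ⟪h, x⟫) (by fun_prop)
  have hUh (i : κ) : MemLp (fun ω ↦ w i * ⟪h, U i ω⟫) 2 P := ((hid i).memLp_iff.2 hZh).const_mul _
  have hsum : (fun ω ↦ ⟪h, ∑ i ∈ s, w i • U i ω⟫) = ∑ i ∈ s, fun ω ↦ w i * ⟪h, U i ω⟫ := by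
    ext ω; simp [inner_sum, inner_smul_right]
  have hmem : MemLp (fun ω ↦ ⟪h, ∑ i ∈ s, w i • U i ω⟫) 2 P := by
    rw [hsum]; exact memLp_finsetSum' _ fun i _ ↦ hUh i
  have hmean : ∫ ω, ⟪h, ∑ i ∈ s, w i • U i ω⟫ ∂P = 0 := by
    simp_rw [inner_sum, inner_smul_right]
    rw [integral_finsetSum _ fun i _ ↦ (hUh i).integrable (by norm_num)]
    refine Finset.sum_eq_zero fun i _ ↦ ?_
    rw [integral_const_mul, (hid i).integral_eq, h0 h, mul_zero]
  have hvar : Var[fun ω ↦ ⟪h, ∑ i ∈ s, w i • U i ω⟫; P] ≤ Var[fun ω ↦ ⟪h, Z ω⟫; P] := by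
    rw [hsum, IndepFun.variance_sum (fun i _ ↦ hUh i)]
    · simp_rw [variance_const_mul, (hid _).variance_eq]
      rw [← Finset.sum_mul]
      exact mul_le_of_le_one_left (variance_nonneg _ _) hw
    · intro i _ j _ hij
      exact (hind.indepFun hij).comp (φ := fun x ↦ w i * ⟪h, x⟫) (ψ := fun x ↦ w j * ⟪h, x⟫)
        (by fun_prop) (by fun_prop)
  have e1 : ∫⁻ ω, ‖⟪h, ∑ i ∈ s, w i • U i ω⟫‖ₑ ^ 2 ∂P =
      ENNReal.ofReal Var[fun ω ↦ ⟪h, ∑ i ∈ s, w i • U i ω⟫; P] := by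
    rw [hmem.ofReal_variance_eq, evariance, hmean]; simp
  have e2 : ∫⁻ ω, ‖⟪h, Z ω⟫‖ₑ ^ 2 ∂P = ENNReal.ofReal Var[fun ω ↦ ⟪h, Z ω⟫; P] := by
    rw [hZh.ofReal_variance_eq, evariance, h0 h]; simp
  rw [e1, e2]
  exact ENNReal.ofReal_le_ofReal hvar

variable [CompleteSpace H]

/-- Pairing with `h` reduces this to the real law of ⟨h, Z⟩, whose variance is the covariance form
at `h`. -/
lemma tendsto_charFun_weightedSum {l : Filter β} (hU : ∀ i, IdentDistrib (U i) Z P P)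
    (hind : iIndepFun U P) (hZ : MemLp Z 2 P) (h0 : ∀ h : H, ∫ ω, ⟪h, Z ω⟫ ∂P = 0)
    {s : β → Finset κ} {w : β → κ → ℝ} (hw : ∀ᶠ p in l, ∑ i ∈ s p, w p i ^ 2 = 1)
    (hsmall : ∀ δ > 0, ∀ᶠ p in l, ∀ i ∈ s p, |w p i| < δ) (h : H) :
    Tendsto (fun p ↦ charFun (P.map fun ω ↦ ∑ i ∈ s p, w p i • U i ω) h) l
      (𝓝 (Complex.exp (-(covarianceBilin (P.map Z) h h : ℝ) / 2))) := by
  have hZm : AEMeasurable Z P := hZ.1.aemeasurable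
  have hZh : MemLp (fun ω ↦ ⟪h, Z ω⟫) 2 P := hZ.const_inner h
  have hprob : IsProbabilityMeasure (P.map fun ω ↦ ⟪h, Z ω⟫) :=
    Measure.isProbabilityMeasure_map (by fun_prop)
  have hprob' : IsProbabilityMeasure (P.map Z) := Measure.isProbabilityMeasure_map hZm
  have hmem : MemLp id 2 (P.map Z) := (memLp_map_measure_iff aestronglyMeasurable_id hZm).2 hZ
  have hmem' : MemLp id 2 (P.map fun ω ↦ ⟪h, Z ω⟫) :=
    (memLp_map_measure_iff aestronglyMeasurable_id (by fun_prop)).2 hZh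
  have hvar : covarianceBilin (P.map Z) h h = Var[id; P.map fun ω ↦ ⟪h, Z ω⟫] := by
    rw [covarianceBilin_self hmem, variance_map (by fun_prop) (by fun_prop),
      variance_map (by fun_prop) (by fun_prop)]
    rfl
  rw [hvar]
  refine (tendsto_prod_charFun_of_sum_sq_eq_one hmem' ?_ hw hsmall).congr fun p ↦ ?_
  · rw [integral_map (by fun_prop) (by fun_prop)]
    exact h0 h
  · have hUm (i : κ) : AEMeasurable (fun ω ↦ w p i • U i ω) P :=
      (hU i).aemeasurable_fst.const_smul _
    have hind' : iIndepFun (fun i ω ↦ w p i • U i ω) P :=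
      hind.comp (fun i x ↦ w p i • x) fun i ↦ by fun_prop
    rw [iIndepFun.charFun_map_fun_finsetSum_eq_prod (fun i _ ↦ hUm i) (hind'.restrict _),
      Finset.prod_apply]
    refine Finset.prod_congr rfl fun i _ ↦ ?_
    rw [charFun_map_smul_comp (hU i).aemeasurable_fst, (hU i).map_eq, charFun_apply,
      charFun_apply, integral_map (by fun_prop) (by fun_prop),
      integral_map (by fun_prop) (by fun_prop)]
    refine integral_congr_ae (ae_of_all _ fun ω ↦ ?_)
    simp [inner_smul_right, real_inner_comm h, mul_comm]

/-- **Central limit theorem** for weighted sums of independent, identically distributed, centred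
random elements of a separable Hilbert space. -/
theorem exists_isGaussian_tendsto_weightedSum {l : Filter β} [l.NeBot]
    (hU : ∀ i, IdentDistrib (U i) Z P P)
    (hind : iIndepFun U P) (hZ : MemLp Z 2 P) (h0 : ∫ ω, Z ω ∂P = 0)
    {s : β → Finset κ} {w : β → κ → ℝ} (hw' : ∀ p, ∑ i ∈ s p, w p i ^ 2 ≤ 1)
    (hw : ∀ᶠ p in l, ∑ i ∈ s p, w p i ^ 2 = 1)
    (hsmall : ∀ δ > 0, ∀ᶠ p in l, ∀ i ∈ s p, |w p i| < δ) :
    ∃ (γ : Measure H) (_ : IsProbabilityMeasure γ), IsGaussian γ ∧ ∫ x, x ∂γ = 0 ∧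
      covarianceBilin γ = covarianceBilin (P.map Z) ∧
      TendstoInDistribution (fun p ω ↦ ∑ i ∈ s p, w p i • U i ω) l id (fun _ ↦ P) γ := by
  have h0' (h : H) : ∫ ω, ⟪h, Z ω⟫ ∂P = 0 := by
    rw [integral_inner (hZ.integrable (by norm_num)), h0, inner_zero_right]
  have hmeas (p : β) : AEMeasurable (fun ω ↦ ∑ i ∈ s p, w p i • U i ω) P :=
    Finset.aemeasurable_fun_sum _ fun i _ ↦ (hU i).aemeasurable_fst.const_smul _
  let L (p : β) : ProbabilityMeasure H :=
    ⟨P.map fun ω ↦ ∑ i ∈ s p, w p i • U i ω, Measure.isProbabilityMeasure_map (hmeas p)⟩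
  obtain ⟨b, e, -⟩ := exists_hilbertBasis ℝ H
  have := e.orthonormal.countable_of_separableSpace
  have hcomp : IsCompact (closure (Set.range L)) := by
    refine isCompact_closure_of_isTightMeasureSet ?_
    refine isTightMeasureSet_of_lintegral_inner_sq_le e
      (c := fun i ↦ ∫⁻ ω, ‖⟪e i, Z ω⟫‖ₑ ^ 2 ∂P) ?_ ?_
    · have hZm : AEMeasurable Z P := hZ.1.aemeasurable
      rw [← lintegral_tsum fun i ↦ by fun_prop]
      simp_rw [e.tsum_enorm_inner_sq]
      have := hZ.eLpNorm_lt_top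
      rw [eLpNorm_lt_top_iff_lintegral_rpow_enorm_lt_top (by norm_num) (by norm_num)] at this
      simpa using this.ne
    · rintro _ ⟨_, ⟨p, rfl⟩, rfl⟩ i
      change ∫⁻ x, ‖⟪e i, x⟫‖ₑ ^ 2 ∂(P.map fun ω ↦ ∑ i ∈ s p, w p i • U i ω) ≤ _
      rw [lintegral_map' (by fun_prop) (hmeas p)]
      exact lintegral_inner_weightedSum_sq_le hU hind hZ h0' _ _ (hw' p) _
  -- By compactness the laws converge along every ultrafilter finer than `l`, and the limit of the
  -- characteristic functions identifies the limit law.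
  have hlim (V : Ultrafilter β) (hV : (V : Filter β) ≤ l) : ∃ γ : ProbabilityMeasure H,
      Tendsto L V (𝓝 γ) ∧ ∀ h, charFun (γ : Measure H) h =
        Complex.exp (-(covarianceBilin (P.map Z) h h : ℝ) / 2) := by
    obtain ⟨γ, -, hγ⟩ := hcomp.ultrafilter_le_nhds (V.map L)
      (le_principal_iff.2 (Filter.mem_map.2 (Filter.univ_mem' fun p ↦
        subset_closure (Set.mem_range_self p))))
    refine ⟨γ, hγ, fun h ↦ ?_⟩
    exact tendsto_nhds_unique (ProbabilityMeasure.tendsto_charFun_of_tendsto hγ h)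
      ((tendsto_charFun_weightedSum hU hind hZ h0' hw hsmall h).mono_left hV)
  obtain ⟨γ, -, hγ⟩ := hlim (Ultrafilter.of l) (Ultrafilter.of_le l)
  have hγ' (h : H) : charFun (γ : Measure H) h =
      Complex.exp (⟪h, 0⟫ * Complex.I - covarianceBilin (P.map Z) h h / 2) := by
    rw [hγ]; congr 1; simp; ring
  have hpos := isPosSemidef_covarianceBilin (μ := P.map Z)
  have hG : IsGaussian (γ : Measure H) := isGaussian_iff_gaussian_charFun.2 ⟨0, _, hpos, hγ'⟩
  obtain ⟨hm, hc⟩ := gaussian_charFun_congr 0 _ hpos hγ'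
  refine ⟨γ, inferInstance, hG, hm.symm, hc.symm, hmeas, aemeasurable_id, ?_⟩
  -- All ultrafilter limits share one characteristic function, hence coincide with γ; this is
  -- convergence along `l`.
  refine (tendsto_iff_ultrafilter _ _ _).2 fun V hV ↦ ?_
  obtain ⟨γ', hγ'lim, hγ'char⟩ := hlim V hV
  have : γ' = γ := ProbabilityMeasure.toMeasure_injective
    (Measure.ext_of_charFun (funext fun h ↦ (hγ'char h).trans (hγ h).symm))
  subst this
  convert! hγ'lim using 2
  exact congrArg 𝓝 (ProbabilityMeasure.toMeasure_injective
    (Measure.map_id (μ := (γ' : Measure H))))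

end WeightedSum

/-! ### Covariances of integrated random fields, and odd integrands -/

lemma abs_CS_le (x : ℝ) : |CS x| ≤ 2 := by
  have h1 := Real.abs_cos_le_one x
  have h2 := Real.abs_sin_le_one x
  exact (abs_add_le _ _).trans (by linarith)

@[fun_prop]
lemma continuous_CS : Continuous CS := Real.continuous_cos.add Real.continuous_sin

lemma norm_toLp_sq_eq_integral {α : Type*} [MeasurableSpace α] {μ : Measure α} {f : α → ℝ}
    (hf : MemLp f 2 μ) : ‖hf.toLp f‖ ^ 2 = ∫ t, f t ^ 2 ∂μ := by
  rw [← real_inner_self_eq_norm_sq, L2.inner_def]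
  refine integral_congr_ae ?_
  filter_upwards [hf.coeFn_toLp] with t ht
  rw [ht]; simp [sq]

lemma integral_integral_mul_swap {α Ω : Type*} [MeasurableSpace α] [MeasurableSpace Ω]
    {μ : Measure α} [SFinite μ] {P : Measure Ω} [IsFiniteMeasure P] {u : α → ℝ}
    (hu : Integrable u μ) {B : α → Ω → ℝ} (hB : Measurable (Function.uncurry B)) {C : ℝ}
    (hC : ∀ s ω, |B s ω| ≤ C) :
    ∫ ω, ∫ s, u s * B s ω ∂μ ∂P = ∫ s, u s * ∫ ω, B s ω ∂P ∂μ := by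
  have hint : Integrable (Function.uncurry fun s ω ↦ u s * B s ω) (μ.prod P) :=
    (hu.comp_fst P).mul_bdd (c := C) hB.aestronglyMeasurable (ae_of_all _ fun p ↦ hC p.1 p.2)
  rw [← integral_integral_swap hint]
  simp_rw [integral_const_mul]

/-- The covariance of `∫ u(s) A(s) μ(ds)` and `∫ v(t) A(t) μ(dt)` for a bounded random field `A`. -/
lemma covariance_integral_mul {α Ω : Type*} [MeasurableSpace α] [MeasurableSpace Ω]
    {μ : Measure α} [SFinite μ] {P : Measure Ω} [IsProbabilityMeasure P] {u v : α → ℝ}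
    (hu : Integrable u μ) (hv : Integrable v μ) (hvm : Measurable v) {A : α → Ω → ℝ}
    (hA : Measurable (Function.uncurry A)) {C : ℝ} (hC : ∀ s ω, |A s ω| ≤ C) :
    cov[fun ω ↦ ∫ s, u s * A s ω ∂μ, fun ω ↦ ∫ t, v t * A t ω ∂μ; P] =
      ∫ s, ∫ t, cov[A s, A t; P] * u s * v t ∂μ ∂μ := by
  have hAm : Measurable fun s ↦ ∫ ω', A s ω' ∂P :=
    (hA.stronglyMeasurable.integral_prod_right).measurable
  -- By Fubini, centring passes inside the μ-integral and replaces `A` by the centred field `D`.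
  obtain ⟨D, hD'⟩ : ∃ D : α → Ω → ℝ, ∀ s ω, D s ω = A s ω - ∫ ω', A s ω' ∂P := ⟨_, fun _ _ ↦ rfl⟩
  have hD : Measurable fun p : α × Ω ↦ D p.1 p.2 := by
    simp_rw [hD']
    exact hA.sub (hAm.comp measurable_fst)
  have hAint (s : α) : |∫ ω', A s ω' ∂P| ≤ C := by
    have := norm_integral_le_of_norm_le_const (μ := P) (f := A s) (C := C)
      (ae_of_all _ fun ω ↦ hC s ω)
    simpa using this
  have hDb (s : α) (ω : Ω) : |D s ω| ≤ 2 * C := by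
    rw [hD']
    exact (abs_sub _ _).trans (by linarith [hAint s, hC s ω])
  have hcentre {u : α → ℝ} (hu : Integrable u μ) (ω : Ω) :
      ∫ s, u s * A s ω ∂μ - ∫ ω', ∫ s, u s * A s ω' ∂μ ∂P = ∫ s, u s * D s ω ∂μ := by
    rw [integral_integral_mul_swap hu hA hC, ← integral_sub]
    · simp_rw [hD', mul_sub]
    · exact hu.mul_bdd (c := C)
        (hA.comp measurable_prodMk_right).aestronglyMeasurable (ae_of_all _ fun s ↦ hC s ω)
    · exact hu.mul_bdd (c := C) hAm.aestronglyMeasurable (ae_of_all _ hAint)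
  obtain ⟨G, hG'⟩ : ∃ G : Ω → ℝ, ∀ ω, G ω = ∫ t, v t * D t ω ∂μ := ⟨_, fun _ ↦ rfl⟩
  have hG : Measurable G := by
    have h1 : Measurable fun p : Ω × α ↦ v p.2 * D p.2 p.1 :=
      (hvm.comp measurable_snd).mul (hD.comp measurable_swap)
    rw [funext hG']
    exact h1.stronglyMeasurable.integral_prod_right'.measurable
  -- This makes `D s ω * G ω` bounded, so that Fubini applies with the whole second integral kept as
  -- a factor.
  have hGb (ω : Ω) : |G ω| ≤ ∫ t, ‖v t‖ * (2 * C) ∂μ := by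
    rw [hG']
    refine (norm_integral_le_integral_norm fun t ↦ v t * D t ω).trans ?_
    refine integral_mono_of_nonneg (ae_of_all _ fun _ ↦ norm_nonneg _)
      (hv.norm.mul_const _) (ae_of_all _ fun t ↦ ?_)
    change ‖v t * D t ω‖ ≤ ‖v t‖ * (2 * C)
    rw [norm_mul]
    gcongr
    exact hDb t ω
  rw [covariance]
  simp_rw [hcentre hu, hcentre hv, ← hG', ← integral_mul_const, mul_assoc]
  rw [integral_integral_mul_swap (B := fun s ω ↦ D s ω * G ω)
    (C := (2 * C) * ∫ t, ‖v t‖ * (2 * C) ∂μ) hu (hD.mul (hG.comp measurable_snd))]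
  · congr 1 with s
    have h1 : ∫ ω, D s ω * G ω ∂P = ∫ t, v t * ∫ ω, D s ω * D t ω ∂P ∂μ := by
      rw [← integral_integral_mul_swap (B := fun t ω ↦ D s ω * D t ω) (C := (2 * C) * (2 * C)) hv]
      · congr 1 with ω
        rw [hG', ← integral_const_mul]
        congr 1 with t
        ring
      · have h2 : Measurable fun p : α × Ω ↦ D s p.2 :=
          (hD.comp measurable_prodMk_left).comp measurable_snd
        exact h2.mul hD
      · intro t ω
        rw [abs_mul]
        exact mul_le_mul (hDb _ _) (hDb _ _) (abs_nonneg _) ((abs_nonneg _).trans (hDb s ω))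
    rw [h1, ← integral_const_mul]
    congr 1 with t
    simp_rw [covariance, hD']
    ring
  · intro s ω
    rw [abs_mul]
    exact mul_le_mul (hDb _ _) (hGb _) (abs_nonneg _) ((abs_nonneg _).trans (hDb s ω))

lemma measurable_reflect {d : ℕ} {M : Set (EuclideanSpace ℝ (Fin d))} (hM : -M = M) :
    Measurable (reflect hM) :=
  Measurable.subtype_mk (by fun_prop)

lemma integral_eq_zero_of_odd {d : ℕ} {M : Set (EuclideanSpace ℝ (Fin d))} (μ : Measure M)
    (hM : -M = M) (hμ : μ.map (reflect hM) = μ) {f : M → ℝ}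
    (hf : Measurable f) (hodd : ∀ t, f (reflect hM t) = -f t) : ∫ t, f t ∂μ = 0 := by
  have h : ∫ t, f t ∂μ = ∫ t, f (reflect hM t) ∂μ := by
    conv_lhs => rw [← hμ]
    exact integral_map (measurable_reflect hM).aemeasurable hf.aestronglyMeasurable
  simp_rw [hodd, integral_neg] at h
  linarith

/-! ### The embedding of sample points into L²(μ) -/

section CSLp

variable {d : ℕ} {M : Set (EuclideanSpace ℝ (Fin d))} (μ : Measure M) [IsFiniteMeasure μ]

lemma memLp_CS (x : EuclideanSpace ℝ (Fin d)) :
    MemLp (fun t : M ↦ CS ⟪(t : EuclideanSpace ℝ (Fin d)), x⟫) 2 μ :=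
  MemLp.of_bound (by fun_prop) 2 (ae_of_all _ fun _ ↦ abs_CS_le _)

/-- The function `t ↦ CS (tᵀ x)` as an element of `L²(μ)`. -/
noncomputable def csLp (x : EuclideanSpace ℝ (Fin d)) : Lp ℝ 2 μ := (memLp_CS μ x).toLp _

lemma continuous_csLp : Continuous (csLp μ) := by
  rw [continuous_iff_continuousAt]
  intro x
  rw [ContinuousAt, tendsto_iff_norm_sub_tendsto_zero]
  have h (y : EuclideanSpace ℝ (Fin d)) : ‖csLp μ y - csLp μ x‖ ^ 2 =
      ∫ t : M, (CS ⟪(t : EuclideanSpace ℝ (Fin d)), y⟫ -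
        CS ⟪(t : EuclideanSpace ℝ (Fin d)), x⟫) ^ 2 ∂μ := by
    rw [csLp, csLp, ← MemLp.toLp_sub, norm_toLp_sq_eq_integral]
    rfl
  have hlim : Tendsto (fun y ↦ ‖csLp μ y - csLp μ x‖ ^ 2) (𝓝 x) (𝓝 0) := by
    simp_rw [h]
    have : (0 : ℝ) = ∫ t : M, (CS ⟪(t : EuclideanSpace ℝ (Fin d)), x⟫ -
        CS ⟪(t : EuclideanSpace ℝ (Fin d)), x⟫) ^ 2 ∂μ := by simp
    rw [this]
    refine tendsto_integral_filter_of_dominated_convergence (fun _ ↦ 16)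
      (Eventually.of_forall fun y ↦ by fun_prop) (Eventually.of_forall fun y ↦
        ae_of_all _ fun t ↦ ?_) (integrable_const _) (ae_of_all _ fun t ↦ ?_)
    · have h1 := abs_le.1 (abs_CS_le ⟪(t : EuclideanSpace ℝ (Fin d)), y⟫)
      have h2 := abs_le.1 (abs_CS_le ⟪(t : EuclideanSpace ℝ (Fin d)), x⟫)
      rw [Real.norm_of_nonneg (sq_nonneg _)]
      nlinarith
    · exact Continuous.tendsto (by fun_prop) x
  have := (Real.continuous_sqrt.tendsto 0).comp hlim
  simpa [Function.comp_def, Real.sqrt_sq (norm_nonneg _)] using this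

lemma inner_csLp (u : Lp ℝ 2 μ) (x : EuclideanSpace ℝ (Fin d)) :
    ⟪u, csLp μ x⟫ = ∫ t : M, u t * CS ⟪(t : EuclideanSpace ℝ (Fin d)), x⟫ ∂μ := by
  rw [L2.inner_def]
  refine integral_congr_ae ?_
  filter_upwards [(memLp_CS μ x).coeFn_toLp] with t ht
  rw [csLp, ht]; simp [mul_comm]

lemma norm_csLp_le (x : EuclideanSpace ℝ (Fin d)) : ‖csLp μ x‖ ^ 2 ≤ 4 * μ.real Set.univ := by
  rw [csLp, norm_toLp_sq_eq_integral]
  calc _ ≤ ∫ _ : M, (4 : ℝ) ∂μ := by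
        refine integral_mono_of_nonneg (ae_of_all _ fun _ ↦ sq_nonneg _) (integrable_const _)
          (ae_of_all _ fun t ↦ ?_)
        have h1 := abs_le.1 (abs_CS_le ⟪(t : EuclideanSpace ℝ (Fin d)), x⟫)
        change CS ⟪(t : EuclideanSpace ℝ (Fin d)), x⟫ ^ 2 ≤ 4
        nlinarith
    _ = _ := by simp [mul_comm]

lemma covariance_inner_csLp {Ω : Type*} [MeasurableSpace Ω] {P : Measure Ω}
    [IsProbabilityMeasure P] {X : Ω → EuclideanSpace ℝ (Fin d)} (hX : Measurable X)
    (u v : Lp ℝ 2 μ) :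
    cov[fun ω ↦ ⟪u, csLp μ (X ω)⟫, fun ω ↦ ⟪v, csLp μ (X ω)⟫; P] =
      ∫ s : M, ∫ t : M, cov[fun ω ↦ CS ⟪(s : EuclideanSpace ℝ (Fin d)), X ω⟫,
        fun ω ↦ CS ⟪(t : EuclideanSpace ℝ (Fin d)), X ω⟫; P] * u s * v t ∂μ ∂μ := by
  have hA : Measurable fun p : M × Ω ↦ CS ⟪(p.1 : EuclideanSpace ℝ (Fin d)), X p.2⟫ := by fun_prop
  simp_rw [inner_csLp]
  exact covariance_integral_mul ((Lp.memLp u).integrable (by norm_num))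
    ((Lp.memLp v).integrable (by norm_num)) (Lp.stronglyMeasurable v).measurable
    (A := fun (t : M) ω ↦ CS ⟪(t : EuclideanSpace ℝ (Fin d)), X ω⟫) hA fun _ _ ↦ abs_CS_le _

/-- With a the cosine sum and b the sine sum, the two sides are ∫ (a² + b²) and ∫ (a + b)². They
differ by 2 ∫ a b, which vanishes since a is even and b is odd. -/
lemma integral_norm_weightedSum_exp_sq (hM : -M = M) (hμ : μ.map (reflect hM) = μ) {κ : Type*}
    (s : Finset κ) (w : κ → ℝ) (z : κ → EuclideanSpace ℝ (Fin d)) :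
    ∫ t : M, ‖∑ i ∈ s, (w i : ℂ) *
      Complex.exp (Complex.I * ((⟪(t : EuclideanSpace ℝ (Fin d)), z i⟫ : ℝ) : ℂ))‖ ^ 2 ∂μ =
    ‖∑ i ∈ s, w i • csLp μ (z i)‖ ^ 2 := by
  let a (t : M) : ℝ := ∑ i ∈ s, w i * Real.cos ⟪(t : EuclideanSpace ℝ (Fin d)), z i⟫
  let b (t : M) : ℝ := ∑ i ∈ s, w i * Real.sin ⟪(t : EuclideanSpace ℝ (Fin d)), z i⟫
  have ha : Measurable a := by unfold a; fun_prop
  have hb : Measurable b := by unfold b; fun_prop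
  have hbound (f : ℝ → ℝ) (hf : ∀ x, |f x| ≤ 1) (t : M) :
      |∑ i ∈ s, w i * f ⟪(t : EuclideanSpace ℝ (Fin d)), z i⟫| ≤ ∑ i ∈ s, |w i| := by
    refine (Finset.abs_sum_le_sum_abs _ _).trans (Finset.sum_le_sum fun i _ ↦ ?_)
    rw [abs_mul]
    exact mul_le_of_le_one_right (abs_nonneg _) (hf _)
  have haL : MemLp a 2 μ := MemLp.of_bound ha.aestronglyMeasurable _
    (ae_of_all _ (hbound _ Real.abs_cos_le_one))
  have hbL : MemLp b 2 μ := MemLp.of_bound hb.aestronglyMeasurable _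
    (ae_of_all _ (hbound _ Real.abs_sin_le_one))
  have hsum : ∑ i ∈ s, w i • csLp μ (z i) = (haL.add hbL).toLp _ := by
    refine Lp.ext ?_
    refine EventuallyEq.trans ?_ (haL.add hbL).coeFn_toLp.symm
    have h1 : ∀ᵐ t ∂μ, ∀ i ∈ s, (w i • csLp μ (z i) : Lp ℝ 2 μ) t =
        w i * CS ⟪(t : EuclideanSpace ℝ (Fin d)), z i⟫ := by
      rw [Finset.eventually_all]
      intro i _
      filter_upwards [Lp.coeFn_smul (w i) (csLp μ (z i)), (memLp_CS μ (z i)).coeFn_toLp]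
        with t h1 h2
      rw [h1, Pi.smul_apply, csLp, h2, smul_eq_mul]
    filter_upwards [Lp.coeFn_finsetSum s fun i ↦ w i • csLp μ (z i), h1] with t h2 h1
    rw [h2, Finset.sum_apply, Finset.sum_congr rfl h1, Pi.add_apply, ← Finset.sum_add_distrib]
    simp [CS, mul_add]
  have hnorm (t : M) : ‖∑ i ∈ s, (w i : ℂ) *
      Complex.exp (Complex.I * ((⟪(t : EuclideanSpace ℝ (Fin d)), z i⟫ : ℝ) : ℂ))‖ ^ 2 =
      a t ^ 2 + b t ^ 2 := by
    rw [← Complex.normSq_eq_norm_sq, Complex.normSq_apply, Complex.re_sum, Complex.im_sum]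
    simp only [Complex.re_ofReal_mul, Complex.im_ofReal_mul, mul_comm Complex.I,
      Complex.exp_ofReal_mul_I_re, Complex.exp_ofReal_mul_I_im]
    simp only [a, b]; ring
  have hab : ∫ t, a t * b t ∂μ = 0 := by
    refine integral_eq_zero_of_odd μ hM hμ (ha.mul hb) fun t ↦ ?_
    simp [a, b, reflect, inner_neg_left]
  rw [hsum, norm_toLp_sq_eq_integral]
  simp_rw [hnorm, Pi.add_apply, add_sq]
  have hia : Integrable (fun t ↦ a t ^ 2) μ := haL.integrable_sq
  have hib : Integrable (fun t ↦ b t ^ 2) μ := hbL.integrable_sq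
  have hiab : Integrable (fun t ↦ a t * b t) μ := haL.integrable_mul hbL
  simp_rw [mul_assoc]
  have hiab' : Integrable (fun t ↦ a t ^ 2 + 2 * (a t * b t)) μ := hia.add (hiab.const_mul 2)
  rw [integral_add hia hib, integral_add hiab' hib, integral_add hia (hiab.const_mul 2),
    integral_const_mul, hab]
  ring

end CSLp

/-! ### Two-sample weights -/

/-- The normalised weights of the two-sample problem with sample sizes `p.1` and `p.2`. -/
noncomputable def twoSampleWeight (p : ℕ × ℕ) : ℕ ⊕ ℕ → ℝ :=
  Sum.elim (fun _ ↦ √((p.1 : ℝ) * p.2 / (p.1 + p.2)) * (1 / p.1))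
    fun _ ↦ -(√((p.1 : ℝ) * p.2 / (p.1 + p.2)) * (1 / p.2))

/-- The index set of the two samples of sizes `p.1` and `p.2`. -/
def twoSampleIndex (p : ℕ × ℕ) : Finset (ℕ ⊕ ℕ) :=
  (Finset.range p.1).disjSum (Finset.range p.2)

lemma sum_twoSampleWeight_sq {n m : ℕ} (hn : 0 < n) (hm : 0 < m) :
    ∑ i ∈ twoSampleIndex (n, m), twoSampleWeight (n, m) i ^ 2 = 1 := by
  have hn' : (0 : ℝ) < n := Nat.cast_pos.2 hn
  have hm' : (0 : ℝ) < m := Nat.cast_pos.2 hm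
  have h : √((n : ℝ) * m / (n + m)) ^ 2 = n * m / (n + m) := Real.sq_sqrt (by positivity)
  simp only [twoSampleIndex, twoSampleWeight, Finset.sum_disjSum, Sum.elim_inl, Sum.elim_inr,
    Finset.sum_const, Finset.card_range, nsmul_eq_mul, neg_sq, mul_pow, h]
  field_simp
  ring

lemma sum_twoSampleWeight_eq_zero (p : ℕ × ℕ) :
    ∑ i ∈ twoSampleIndex p, twoSampleWeight p i = 0 := by
  obtain ⟨n, m⟩ := p
  simp only [twoSampleIndex, twoSampleWeight, Finset.sum_disjSum, Sum.elim_inl, Sum.elim_inr,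
    Finset.sum_const, Finset.card_range, nsmul_eq_mul]
  rcases Nat.eq_zero_or_pos n with rfl | hn
  · simp
  rcases Nat.eq_zero_or_pos m with rfl | hm
  · simp
  field_simp
  ring

lemma sum_twoSampleWeight_sq_le_one (p : ℕ × ℕ) :
    ∑ i ∈ twoSampleIndex p, twoSampleWeight p i ^ 2 ≤ 1 := by
  obtain ⟨n, m⟩ := p
  rcases Nat.eq_zero_or_pos n with rfl | hn
  · simp [twoSampleIndex, twoSampleWeight]
  rcases Nat.eq_zero_or_pos m with rfl | hm
  · simp [twoSampleIndex, twoSampleWeight]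
  exact (sum_twoSampleWeight_sq hn hm).le

lemma eventually_sum_twoSampleWeight_sq :
    ∀ᶠ p in atTop ×ˢ atTop, ∑ i ∈ twoSampleIndex p, twoSampleWeight p i ^ 2 = 1 := by
  filter_upwards [(eventually_gt_atTop 0).prod_mk (eventually_gt_atTop 0)] with p hp
  exact sum_twoSampleWeight_sq hp.1 hp.2

lemma eventually_abs_twoSampleWeight_lt (δ : ℝ) (hδ : 0 < δ) :
    ∀ᶠ p in atTop ×ˢ atTop, ∀ i ∈ twoSampleIndex p, |twoSampleWeight p i| < δ := by
  have hlim : ∀ᶠ n : ℕ in atTop, 0 < n ∧ 1 / (n : ℝ) < δ ^ 2 :=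
    (eventually_gt_atTop 0).and
      (tendsto_one_div_atTop_nhds_zero_nat.eventually_lt_const (by positivity))
  filter_upwards [hlim.prod_mk hlim] with p hp i _
  obtain ⟨n, m⟩ := p
  obtain ⟨⟨hn, hn2⟩, hm, hm2⟩ := hp
  have hn' : (0 : ℝ) < n := Nat.cast_pos.2 hn
  have hm' : (0 : ℝ) < m := Nat.cast_pos.2 hm
  have h : √((n : ℝ) * m / (n + m)) ^ 2 = n * m / (n + m) := Real.sq_sqrt (by positivity)
  refine abs_lt_of_sq_lt_sq ?_ hδ.le
  cases i with
  | inl j =>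
    refine lt_of_le_of_lt ?_ hn2
    simp only [twoSampleWeight, Sum.elim_inl, mul_pow, h]
    -- The factor m/(n+m) is at most 1 for every ratio, which is why n and m may grow in any manner.
    rw [show (n : ℝ) * m / (n + m) * (1 / n) ^ 2 = 1 / n * (m / (n + m)) by field_simp]
    exact mul_le_of_le_one_right (by positivity) ((div_le_one (by positivity)).2 (by linarith))
  | inr j =>
    refine lt_of_le_of_lt ?_ hm2
    simp only [twoSampleWeight, Sum.elim_inr, neg_sq, mul_pow, h]
    rw [show (n : ℝ) * m / (n + m) * (1 / m) ^ 2 = 1 / m * (n / (n + m)) by field_simp]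
    exact mul_le_of_le_one_right (by positivity) ((div_le_one (by positivity)).2 (by linarith))

/-- The root of the prefactor is absorbed into the weights. As these sum to zero, the shift `c` is
arbitrary and can later be taken as the common mean. -/
lemma cfStatistic_eq_norm_sq {d : ℕ} {M : Set (EuclideanSpace ℝ (Fin d))} (hM : -M = M)
    (μ : Measure M) [IsFiniteMeasure μ] (hμ : μ.map (reflect hM) = μ)
    (x y : ℕ → EuclideanSpace ℝ (Fin d)) (p : ℕ × ℕ) (c : Lp ℝ 2 μ) :
    cfStatistic μ x y p.1 p.2 =
      ‖∑ i ∈ twoSampleIndex p, twoSampleWeight p i • (csLp μ (Sum.elim x y i) - c)‖ ^ 2 := by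
  have hc : ∑ i ∈ twoSampleIndex p, twoSampleWeight p i • (csLp μ (Sum.elim x y i) - c) =
      ∑ i ∈ twoSampleIndex p, twoSampleWeight p i • csLp μ (Sum.elim x y i) := by
    simp_rw [smul_sub, Finset.sum_sub_distrib, ← Finset.sum_smul, sum_twoSampleWeight_eq_zero,
      zero_smul, sub_zero]
  rw [hc, ← integral_norm_weightedSum_exp_sq μ hM hμ, cfStatistic, ← integral_const_mul]
  congr 1 with t
  have h : (p.1 : ℝ) * p.2 / (p.1 + p.2) =
      ‖((√((p.1 : ℝ) * p.2 / (p.1 + p.2)) : ℝ) : ℂ)‖ ^ 2 := by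
    rw [Complex.norm_real, Real.norm_eq_abs, sq_abs, Real.sq_sqrt (by positivity)]
  rw [h, ← mul_pow, ← norm_mul]
  congr 2
  simp only [twoSampleIndex, twoSampleWeight, Finset.sum_disjSum, Sum.elim_inl, Sum.elim_inr,
    empCharFun, mul_add, Finset.mul_sum, sub_eq_add_neg, ← Finset.sum_neg_distrib]
  push_cast
  refine congrArg₂ (· + ·) ?_ ?_ <;> refine Finset.sum_congr rfl fun i _ ↦ ?_ <;> ring

/-! ### The limit theorem for the statistic -/

theorem theorem1 {d : ℕ} {Ω : Type*} [MeasurableSpace Ω] (P : Measure Ω) [IsProbabilityMeasure P]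
    (M : Set (EuclideanSpace ℝ (Fin d))) (hMmeas : MeasurableSet M) (hM : -M = M)
    (μ : Measure M) [IsFiniteMeasure μ] (hμ : μ.map (reflect hM) = μ)
    (X Y : ℕ → Ω → EuclideanSpace ℝ (Fin d))
    (hXmeas : ∀ j, Measurable (X j)) (hYmeas : ∀ k, Measurable (Y k))
    (hindep : iIndepFun (Sum.elim X Y) P)
    (hX : ∀ j, IdentDistrib (X j) (X 0) P P) (hY : ∀ k, IdentDistrib (Y k) (Y 0) P P)
    (hφψ : charFun (P.map (X 0)) = charFun (P.map (Y 0))) :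
    ∃ (Ω' : Type) (_ : MeasurableSpace Ω') (P' : Measure Ω') (_ : IsProbabilityMeasure P')
      (W : Ω' → Lp ℝ 2 μ),
      HasGaussianLaw W P' ∧
      (∫ ω, W ω ∂P') = 0 ∧
      HasCovarianceKernel W P' (fun s t : M ↦
        cov[fun ω ↦ CS ⟪(s : EuclideanSpace ℝ (Fin d)), X 0 ω⟫,
          fun ω ↦ CS ⟪(t : EuclideanSpace ℝ (Fin d)), X 0 ω⟫; P]) ∧
      TendstoInDistribution
        (fun (p : ℕ × ℕ) (ω : Ω) ↦ cfStatistic μ (fun j ↦ X j ω) (fun k ↦ Y k ω) p.1 p.2)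
        (atTop ×ˢ atTop) (fun ω ↦ ‖W ω‖ ^ 2) (fun _ ↦ P) P' := by
  -- The finite exponent gives separability of L²(μ).
  have : Fact ((2 : ℝ≥0∞) ≠ ∞) := ⟨by norm_num⟩
  have hcs : Measurable (csLp μ) := (continuous_csLp μ).measurable
  have hcsX : AEStronglyMeasurable (fun ω ↦ csLp μ (X 0 ω)) P :=
    (hcs.comp (hXmeas 0)).aestronglyMeasurable
  have hL : MemLp (fun ω ↦ csLp μ (X 0 ω)) 2 P :=
    MemLp.of_bound hcsX (√(4 * μ.real Set.univ))
      (ae_of_all _ fun ω ↦ Real.le_sqrt_of_sq_le (norm_csLp_le μ _))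
  obtain ⟨c, hc⟩ : ∃ c, c = ∫ ω, csLp μ (X 0 ω) ∂P := ⟨_, rfl⟩
  have hZ : MemLp (fun ω ↦ csLp μ (X 0 ω) - c) 2 P := hL.sub (memLp_const c)
  have hZ0 : ∫ ω, csLp μ (X 0 ω) - c ∂P = 0 := by
    rw [integral_sub (hL.integrable (by norm_num)) (integrable_const _), hc]; simp
  have hcsc : Measurable fun x ↦ csLp μ x - c := hcs.sub_const c
  have hYX : IdentDistrib (Y 0) (X 0) P P := by
    refine ⟨(hYmeas 0).aemeasurable, (hXmeas 0).aemeasurable, ?_⟩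
    have := Measure.isProbabilityMeasure_map (μ := P) (hXmeas 0).aemeasurable
    have := Measure.isProbabilityMeasure_map (μ := P) (hYmeas 0).aemeasurable
    exact Measure.ext_of_charFun hφψ.symm
  have hU (i : ℕ ⊕ ℕ) : IdentDistrib (fun ω ↦ csLp μ (Sum.elim X Y i ω) - c)
      (fun ω ↦ csLp μ (X 0 ω) - c) P P := by
    cases i with
    | inl j => exact (hX j).comp hcsc
    | inr k => exact ((hY k).trans hYX).comp hcsc
  have hind : iIndepFun (fun i ω ↦ csLp μ (Sum.elim X Y i ω) - c) P :=
    hindep.comp (fun _ x ↦ csLp μ x - c) fun _ ↦ hcsc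
  obtain ⟨γ, hγ, hG, hmean, hcov, hlim⟩ := exists_isGaussian_tendsto_weightedSum
    (l := (atTop ×ˢ atTop : Filter (ℕ × ℕ))) hU hind hZ hZ0
    sum_twoSampleWeight_sq_le_one eventually_sum_twoSampleWeight_sq
    fun δ hδ ↦ eventually_abs_twoSampleWeight_lt δ hδ
  -- The canonical choice: `W` is the identity on L²(μ) under the limit law γ.
  refine ⟨Lp ℝ 2 μ, inferInstance, γ, hγ, id, IsGaussian.hasGaussianLaw_id, hmean, ?_, ?_⟩
  · intro u v
    have hZm : AEMeasurable (fun ω ↦ csLp μ (X 0 ω) - c) P := hZ.1.aemeasurable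
    have := Measure.isProbabilityMeasure_map hZm
    have hmem : MemLp id 2 (P.map fun ω ↦ csLp μ (X 0 ω) - c) :=
      (memLp_map_measure_iff aestronglyMeasurable_id hZm).2 hZ
    calc cov[fun x ↦ ⟪u, id x⟫, fun x ↦ ⟪v, id x⟫; γ] = covarianceBilin γ u v :=
          (covarianceBilin_apply_eq_cov IsGaussian.memLp_two_id u v).symm
      _ = cov[fun ω ↦ ⟪u, csLp μ (X 0 ω) - c⟫, fun ω ↦ ⟪v, csLp μ (X 0 ω) - c⟫; P] := by
          rw [hcov, covarianceBilin_apply_eq_cov hmem,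
            covariance_map (by fun_prop) (by fun_prop) hZm]
          rfl
      _ = cov[fun ω ↦ ⟪u, csLp μ (X 0 ω)⟫, fun ω ↦ ⟪v, csLp μ (X 0 ω)⟫; P] := by
          simp_rw [inner_sub_right]
          rw [covariance_sub_const_left ((hL.const_inner u).integrable (by norm_num)),
            covariance_sub_const_right ((hL.const_inner v).integrable (by norm_num))]
      _ = _ := covariance_inner_csLp μ (hXmeas 0) u v
  · convert! hlim.continuous_comp (g := fun x ↦ ‖x‖ ^ 2) (by fun_prop) using 1
    ext p ω
    rw [cfStatistic_eq_norm_sq hM μ hμ _ _ _ c]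
    have h (i : ℕ ⊕ ℕ) :
        Sum.elim (fun j ↦ X j ω) (fun k ↦ Y k ω) i = Sum.elim X Y i ω := by
      cases i <;> rfl
    simp_rw [h]
    rfl
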